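/- Conventions. A topological space $X$ is \emph{quasi-Polish} if it has a countable base and its topology is induced by a Smyth-complete quasi-metric. Here a quasi-metric is a function $d\colon X\times X\to[0,\infty)$ with $d(x,z)\le d(x,y)+d(y,z)$ and $x=y \iff d(x,y)=d(y,x)=0$; the induced topology has the balls $\{y\mid d(x,y)<\varepsilon\}$ $(\varepsilon>0)$ as a base; and $d$ is Smyth-complete if every sequence $(x_n)$ such that for each $\varepsilon>0$ there is $n_0$ with $d(x_n,x_m)<\varepsilon$ for all $m\ge n\ge n_0$ converges in the metric $\max(d(x,y),d(y,x))$. For a topological space $X$: - $\mathbf{O}(X)$ is the lattice of open subsets of $X$, ordered by inclusion, with the Scott topology; - $\mathbf{A}(X)$ is the set of closed subsets of $X$ with the lower Vietoris topology, generated by the sets $\Diamond U=\{A\in\mathbf{A}(X)\mid A\cap U\neq\emptyset\}$, $U\subseteq X$ open; - $\mathbf{K}(X)$ is the set of compact saturated subsets of $X$ (saturated: equal to the intersection of its open neighbourhoods) with the upper Vietoris topology, generated by the sets $\Box U=\{K\in\mathbf{K}(X)\mid K\subseteq U\}$, $U\subseteq X$ open. A continuous map $f\colon X\to Y$ induces continuous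 maps $\mathbf{O}(f)\colon\mathbf{O}(Y)\to\mathbf{O}(X)$, $U\mapsto f^{-1}(U)$; $\mathbf{A}(f)\colon\mathbf{A}(X)\to\mathbf{A}(Y)$, $A\mapsto \mathrm{Cl}_Y(f(A))$; and $\mathbf{K}(f)\colon\mathbf{K}(X)\to\mathbf{K}(Y)$, $K\mapsto{\uparrow}f(K)$, where $\uparrow$ is the upper closure in the specialization preorder ($x\le y$ iff $x\in\mathrm{Cl}(\{y\})$). Define $$\alpha_X\colon\mathbf{A}(\mathbf{O}(X))\to\mathbf{O}(\mathbf{K}(X)),\quad \alpha_X(\mathfrak{A})=\bigcup_{U\in\mathfrak{A}}\Box U,$$ $$\beta_X\colon\mathbf{O}(\mathbf{K}(X))\to\mathbf{A}(\mathbf{O}(X)),\quad \beta_X(\mathcal{U})=\{U\in\mathbf{O}(X)\mid\Box U\subseteq\mathcal{U}\}.$$ Theorem. Let $X$ be a quasi-Polish space. Then $\alpha_X$ is a homeomorphism, with inverse $\beta_X$, from $\mathbf{A}(\mathbf{O}(X))$ with the lower Vietoris topology onto $\mathbf{O}(\mathbf{K}(X))$ with the Scott topology. Moreover, $\alpha$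 and $\beta$ are natural: for every quasi-Polish space $Y$ and every continuous map $f\colon X\to Y$, $$\alpha_X\circ\mathbf{A}(\mathbf{O}(f))=\mathbf{O}(\mathbf{K}(f))\circ\alpha_Y \quad\text{and}\quad \beta_X\circ\mathbf{O}(\mathbf{K}(f))=\mathbf{A}(\mathbf{O}(f))\circ\beta_Y.$$ -/

import Mathlib

open TopologicalSpace Topology

noncomputable section

/-! ### Quasi-Polish spaces -/

/-- A quasi-metric: a metric without the symmetry axiom, whose separation axiom reads
`x = y ↔ d x y = 0 ∧ d y x = 0`. -/
structure IsQuasiMetric {X : Type*} (d : X → X → ℝ) : Prop where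
  nonneg : ∀ x y, 0 ≤ d x y
  eq_iff : ∀ x y, x = y ↔ d x y = 0 ∧ d y x = 0
  triangle : ∀ x y z, d x z ≤ d x y + d y z

/-- The topology of `X` is the one induced by `d`, i.e. the one with the open balls
`{y | d x y < ε}` (where `0 < ε`) as a basis. -/
def InducesTopology {X : Type*} [TopologicalSpace X] (d : X → X → ℝ) : Prop :=
  ∀ U : Set X, IsOpen U ↔ ∀ x ∈ U, ∃ ε > 0, {y | d x y < ε} ⊆ U

/-- Cauchy sequences of a quasi-metric: the earlier term is the first argument of `d`. -/
def IsQuasiCauchy {X : Type*} (d : X → X → ℝ) (x : ℕ → X) : Prop :=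
  ∀ ε > 0, ∃ N, ∀ n m, N ≤ n → n ≤ m → d (x n) (x m) < ε

/-- Smyth-completeness: every Cauchy sequence converges with respect to the metric
`max (d x y) (d y x)`. -/
def IsSmythComplete {X : Type*} (d : X → X → ℝ) : Prop :=
  ∀ x : ℕ → X, IsQuasiCauchy d x →
    ∃ a, ∀ ε > 0, ∃ N, ∀ n, N ≤ n → max (d (x n) a) (d a (x n)) < ε

/-- A space is quasi-Polish if it is countably based and its topology is induced by a
Smyth-complete quasi-metric. -/
class QuasiPolishSpace (X : Type*) [TopologicalSpace X] : Prop where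
  secondCountable : SecondCountableTopology X
  exists_quasiMetric :
    ∃ d : X → X → ℝ, IsQuasiMetric d ∧ IsSmythComplete d ∧ InducesTopology d

/-! ### The space `O(X)` of open sets -/

/-- `O(X)`: the lattice of open subsets of `X`, ordered by inclusion, with the Scott topology. -/
abbrev OpenSets (X : Type*) [TopologicalSpace X] : Type _ := WithScott (Opens X)

/-- A subset of `O(X)` is Scott-closed iff it is a lower set closed under directed joins. -/
theorem OpenSets.isClosed_iff {X : Type*} [TopologicalSpace X] {S : Set (OpenSets X)} :
    IsClosed S ↔ IsLowerSet S ∧ DirSupClosed S :=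
  IsScott.isClosed_iff_isLowerSet_and_dirSupClosed

/-- A directed join of open sets is their union. -/
theorem OpenSets.mem_of_isLUB {X : Type*} [TopologicalSpace X] {d : Set (OpenSets X)}
    {a : OpenSets X} (ha : IsLUB d a) {x : X} :
    x ∈ WithScott.ofScott a ↔ ∃ U ∈ d, x ∈ WithScott.ofScott U := by
  have h : WithScott.ofScott a = sSup (WithScott.ofScott '' d) := by
    have h' : IsLUB (WithScott.ofScott '' d) (WithScott.ofScott a) := by
      rw [show WithScott.ofScott '' d = (d : Set (Opens X)) from Set.image_id d]
      exact ha
    exact h'.sSup_eq.symm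
  rw [h, Opens.mem_sSup]
  exact Set.exists_mem_image

/-- The functor `O` on continuous maps: `O(f)(U) = f ⁻¹' U`. -/
def OpenSets.map {X Y : Type*} [TopologicalSpace X] [TopologicalSpace Y] (f : C(X, Y)) :
    C(OpenSets Y, OpenSets X) where
  toFun U := WithScott.toScott (Opens.comap f (WithScott.ofScott U))
  continuous_toFun := by
    rw [← IsScott.scottContinuousOn_iff_continuous (D := Set.univ) (fun _ _ _ => trivial)]
    intro d _ _ _ a ha
    refine ⟨?_, fun b hb => ?_⟩
    · rintro _ ⟨U, hU, rfl⟩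
      exact Opens.comap_mono f (ha.1 hU)
    · intro x hx
      obtain ⟨U, hU, hxU⟩ := (OpenSets.mem_of_isLUB ha).1 (show f x ∈ WithScott.ofScott a from hx)
      exact hb ⟨U, hU, rfl⟩ (show x ∈ Opens.comap f (WithScott.ofScott U) from hxU)

/-! ### The lower powerspace `A(X)` -/

/-- `A(X)`: the set of closed subsets of `X`, with the lower Vietoris topology. -/
@[ext]
structure LowerPowerspace (X : Type*) [TopologicalSpace X] where
  carrier : Set X
  isClosed_carrier : IsClosed carrier

namespace LowerPowerspace

/-- `◇U`, the closed sets that meet `U`. -/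
def dia {X : Type*} [TopologicalSpace X] (U : Opens X) : Set (LowerPowerspace X) :=
  {A | (A.carrier ∩ (U : Set X)).Nonempty}

/-- The lower Vietoris topology. -/
instance {X : Type*} [TopologicalSpace X] : TopologicalSpace (LowerPowerspace X) :=
  generateFrom (Set.range dia)

/-- The functor `A` on continuous maps: `A(f)(A)` is the closure of `f '' A`. -/
def map {X Y : Type*} [TopologicalSpace X] [TopologicalSpace Y] (f : C(X, Y)) :
    C(LowerPowerspace X, LowerPowerspace Y) where
  toFun A := ⟨closure (f '' A.carrier), isClosed_closure⟩
  continuous_toFun := by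
    refine continuous_generateFrom_iff.2 ?_
    rintro _ ⟨U, rfl⟩
    refine isOpen_generateFrom_of_mem ⟨Opens.comap f U, ?_⟩
    ext A
    constructor
    · rintro ⟨x, hx, hxU⟩
      exact ⟨f x, subset_closure ⟨x, hx, rfl⟩, hxU⟩
    · rintro ⟨y, hy, hyU⟩
      obtain ⟨_, hzU, x, hx, rfl⟩ := mem_closure_iff.1 hy U U.isOpen hyU
      exact ⟨x, hx, hzU⟩

end LowerPowerspace

/-! ### The upper powerspace `K(X)` -/

/-- `K(X)`: the set of compact saturated subsets of `X`, with the upper Vietoris topology.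
A set is saturated if it equals the intersection of its open neighbourhoods. -/
@[ext]
structure UpperPowerspace (X : Type*) [TopologicalSpace X] where
  carrier : Set X
  isCompact_carrier : IsCompact carrier
  saturated : carrier = ⋂₀ {U : Set X | IsOpen U ∧ carrier ⊆ U}

namespace UpperPowerspace

/-- `□U`, the compact saturated sets contained in `U`. -/
def box {X : Type*} [TopologicalSpace X] (U : Opens X) : Set (UpperPowerspace X) :=
  {K | K.carrier ⊆ U}

/-- The upper Vietoris topology. -/
instance {X : Type*} [TopologicalSpace X] : TopologicalSpace (UpperPowerspace X) :=
  generateFrom (Set.range box)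

theorem isOpen_box {X : Type*} [TopologicalSpace X] (U : Opens X) : IsOpen (box U) :=
  isOpen_generateFrom_of_mem ⟨U, rfl⟩

/-- The functor `K` on continuous maps: `K(f)(K) = ↑(f '' K)`, the upper closure of `f '' K` in the
specialization order (`y` is above `z` iff `z ∈ closure {y}`, i.e. `y ⤳ z`). -/
def map {X Y : Type*} [TopologicalSpace X] [TopologicalSpace Y] (f : C(X, Y)) :
    C(UpperPowerspace X, UpperPowerspace Y) where
  toFun K :=
    { carrier := {y | ∃ x ∈ K.carrier, f x ∈ closure {y}}
      isCompact_carrier := by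
        convert (K.isCompact_carrier.image f.continuous).nhdsKer using 1
        ext y
        simp [mem_nhdsKer_iff_specializes, specializes_iff_mem_closure]
      saturated := by
        have h : {y | ∃ x ∈ K.carrier, f x ∈ closure {y}} = nhdsKer (f '' K.carrier) := by
          ext y
          simp [mem_nhdsKer_iff_specializes, specializes_iff_mem_closure]
        rw [h, ← nhdsKer_def, nhdsKer_nhdsKer] }
  continuous_toFun := by
    refine continuous_generateFrom_iff.2 ?_
    rintro _ ⟨U, rfl⟩
    refine isOpen_generateFrom_of_mem ⟨Opens.comap f U, ?_⟩
    ext K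
    constructor
    · rintro hK y ⟨x, hx, hxy⟩
      exact (specializes_iff_mem_closure.2 hxy).mem_open U.isOpen (hK hx)
    · intro hK x hx
      exact hK ⟨x, hx, subset_closure rfl⟩

end UpperPowerspace

/-! ### The maps between `A(O(X))` and `O(K(X))` -/

open UpperPowerspace (box isOpen_box)

/-- `α_X(𝔄) = ⋃_{U ∈ 𝔄} □U`. -/
def alphaMap (X : Type*) [TopologicalSpace X] (𝔄 : LowerPowerspace (OpenSets X)) :
    OpenSets (UpperPowerspace X) :=
  WithScott.toScott
    ⟨⋃ U ∈ 𝔄.carrier, box (WithScott.ofScott U), isOpen_biUnion fun _ _ => isOpen_box _⟩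

/-- `β_X(𝒰) = {U ∈ O(X) | □U ⊆ 𝒰}`. -/
def betaMap (X : Type*) [TopologicalSpace X] (𝒰 : OpenSets (UpperPowerspace X)) :
    LowerPowerspace (OpenSets X) where
  carrier := {U | box (WithScott.ofScott U) ⊆ SetLike.coe (WithScott.ofScott 𝒰)}
  isClosed_carrier := by
    refine OpenSets.isClosed_iff.2 ⟨fun U V hVU hU K hK => hU (Set.Subset.trans hK hVU), ?_⟩
    intro d hd hne hdir a ha K hK
    obtain ⟨U, hU, hKU⟩ : ∃ U ∈ d, K.carrier ⊆ SetLike.coe (WithScott.ofScott U) := by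
      refine K.isCompact_carrier.induction_on (p := fun s => ∃ U ∈ d,
        s ⊆ SetLike.coe (WithScott.ofScott U)) ?_ ?_ ?_ ?_
      · obtain ⟨U, hU⟩ := hne
        exact ⟨U, hU, Set.empty_subset _⟩
      · rintro s t hst ⟨U, hU, h⟩
        exact ⟨U, hU, hst.trans h⟩
      · rintro s t ⟨U, hU, hs⟩ ⟨V, hV, ht⟩
        obtain ⟨W, hW, hUW, hVW⟩ := hdir U hU V hV
        exact ⟨W, hW, Set.union_subset (hs.trans hUW) (ht.trans hVW)⟩
      · intro x hx
        obtain ⟨U, hU, hxU⟩ := (OpenSets.mem_of_isLUB ha).1 (hK hx)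
        exact ⟨_, mem_nhdsWithin_of_mem_nhds ((WithScott.ofScott U).isOpen.mem_nhds hxU),
          U, hU, subset_rfl⟩
    exact hd hU hKU

end

/-!
The heart of the matter is that a quasi-Polish space `X` is *consonant*
(`QuasiPolishSpace.isConsonant`): if `H` is a Scott-open family of open sets and `U ∈ H`, there is a
compact `K ⊆ U` all of whose open neighbourhoods belong to `H`. In other words, the Scott topology
on `O(X)` is the compact-open topology.

For the proof, cover `U` by formal balls `(x, r)` and use Scott-openness to keep only finitely many
of them with union in `H`; then refine each of these balls by formal balls whose radius is at most
half as large and which lie in it with room to spare, again keep finitely many, and so on. The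
intersection `K` of the unions so obtained is the desired set. By Smyth-completeness a chain of
refinements shrinks to a point that lies in all balls of the chain. As every stage is
finite, König's lemma then shows that any property of sets that is closed under subsets and finite
unions, and that holds locally at the points of `K`, already holds for one of the unions
(`IsCompleteBallScheme.exists_stage`). This gives both the compactness of `K` and the fact that an
open set containing `K` contains one of the unions, hence belongs to `H`.

The argument only uses the combinatorics of formal balls, isolated in `IsCompleteBallScheme`,
which pass to disjoint sums of copies of `X`. So finite sums are consonant as well, which says
that the product of the Scott topologies on `O(X)ⁿ ≃ O(X ⊔ ⋯ ⊔ X)` is the Scott topology.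

Now `α ∘ β = id` since the sets `□U` form a base. Consonance of `X` gives `β ∘ α = id`: if
`U ∉ 𝔄`, it produces a compact `K ⊆ U` such that no `V ∈ 𝔄` contains `K`, so `□U ⊈ α 𝔄`. It also
gives continuity of `β`. For continuity of `α`, a Scott neighbourhood of `α 𝔄` is a neighbourhood of
some finite union `□U₁ ∪ ⋯ ∪ □Uₙ` with `Uᵢ ∈ 𝔄`, and the map `(U₁, …, Uₙ) ↦ □U₁ ∪ ⋯ ∪ □Uₙ`
is jointly continuous by consonance of the `n`-fold sum. Naturality of `α` holds for all spaces,
because `{U | K ⊆ U}` is Scott-open for compact `K`; naturality of `β` follows by inverting `α`.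
-/

open Filter WithScott
open UpperPowerspace (box isOpen_box)

/-! ### Scott-open families of open sets -/

namespace OpenSets

variable {Z : Type*} [TopologicalSpace Z]

theorem mem_of_isOpen_of_le {H : Set (OpenSets Z)} (hH : IsOpen H) {U V : Opens Z}
    (hU : toScott U ∈ H) (hUV : U ≤ V) : toScott V ∈ H :=
  IsScott.isUpperSet_of_isOpen (D := Set.univ) hH (show toScott U ≤ toScott V from hUV) hU

theorem isOpen_of_upper_of_directed {H : Set (OpenSets Z)}
    (h₁ : ∀ U V : Opens Z, U ≤ V → toScott U ∈ H → toScott V ∈ H)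
    (h₂ : ∀ D : Set (Opens Z), D.Nonempty → DirectedOn (· ≤ ·) D → toScott (sSup D) ∈ H →
      ∃ U ∈ D, toScott U ∈ H) : IsOpen H := by
  rw [IsScott.isOpen_iff_isUpperSet_and_dirSupInaccOn (D := Set.univ)]
  refine ⟨fun U V hUV hU => h₁ U V hUV hU, fun D _ hne hD a ha haH => ?_⟩
  have h : a = toScott (sSup (show Set (Opens Z) from D)) :=
    le_antisymm (α := Opens Z) (ha.2 fun U hU => le_sSup (α := Opens Z) hU)
      (sSup_le (α := Opens Z) fun U hU => ha.1 hU)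
  obtain ⟨U, hU, hUH⟩ := h₂ D hne hD (h ▸ haH)
  exact ⟨U, hU, hUH⟩

/-- Scott-open families are inaccessible by arbitrary unions, up to passing to finite subunions. -/
theorem exists_finset_iSup_mem {ι : Type*} {H : Set (OpenSets Z)} (hH : IsOpen H) (U : ι → Opens Z)
    (hU : toScott (⨆ i, U i) ∈ H) : ∃ t : Finset ι, toScott (⨆ i ∈ t, U i) ∈ H := by
  have hmono : Monotone fun t : Finset ι => ⨆ i ∈ t, U i :=
    fun s t hst => biSup_mono fun i hi => hst hi
  have hlub : IsLUB (Set.range fun t : Finset ι => (toScott (⨆ i ∈ t, U i) : OpenSets Z))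
      (toScott (⨆ i, U i)) := by
    rw [iSup_eq_iSup_finset]
    exact isLUB_iSup (α := Opens Z)
  obtain ⟨_, ⟨t, rfl⟩, ht⟩ :=
    ((IsScott.isOpen_iff_isUpperSet_and_dirSupInaccOn (D := Set.univ)).1 hH).2 trivial
      (Set.range_nonempty _) (directedOn_range.2 hmono.directed_le) hlub hU
  exact ⟨t, ht⟩

end OpenSets

theorem IsCompact.exists_mem_subset_of_subset_sSup {Z : Type*} [TopologicalSpace Z] {K : Set Z}
    (hK : IsCompact K) {D : Set (Opens Z)} (hne : D.Nonempty) (hD : DirectedOn (· ≤ ·) D)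
    (h : K ⊆ (sSup D : Opens Z)) : ∃ U ∈ D, K ⊆ U := by
  have := hne.to_subtype
  obtain ⟨U, hU⟩ := hK.elim_directed_cover (fun U : D => ((U : Opens Z) : Set Z))
    (fun U => U.1.isOpen) (fun x hx => by simpa using h hx)
    (fun U V => by
      obtain ⟨W, hW, hUW, hVW⟩ := hD U U.2 V V.2
      exact ⟨⟨W, hW⟩, hUW, hVW⟩)
  exact ⟨U, U.2, hU⟩

theorem OpenSets.isOpen_setOf_subset {Z : Type*} [TopologicalSpace Z] {K : Set Z}
    (hK : IsCompact K) : IsOpen {U : OpenSets Z | K ⊆ (ofScott U : Opens Z)} :=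
  isOpen_of_upper_of_directed (fun _ _ hUV hU => Set.Subset.trans hU hUV)
    fun _ hne hD h => hK.exists_mem_subset_of_subset_sSup hne hD h

/-! ### König's lemma -/

/-- König's lemma for a sequence of finite levels in which every node has a parent on the previous
level. Since parents lie in finite levels, the paths from level `0` to the nodes of level `n`
converge pointwise along an ultrafilter. -/
theorem exists_chain_of_finite_levels {B : Type*} {R : B → B → Prop} {T : ℕ → Set B}
    (hfin : ∀ n, (T n).Finite) (hne : ∀ n, (T n).Nonempty)
    (hpar : ∀ n, ∀ b' ∈ T (n + 1), ∃ b ∈ T n, R b' b) :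
    ∃ s : ℕ → B, (∀ n, s n ∈ T n) ∧ ∀ n, R (s (n + 1)) (s n) := by
  have hpath : ∀ n, ∀ b ∈ T n, ∃ p : ℕ → B,
      (∀ m ≤ n, p m ∈ T m) ∧ (∀ m < n, R (p (m + 1)) (p m)) ∧ p n = b := by
    intro n
    induction n with
    | zero =>
      intro b hb
      exact ⟨fun _ => b, fun m hm => by rwa [Nat.le_zero.1 hm], fun m hm => by omega, rfl⟩
    | succ n ih =>
      intro b' hb'
      obtain ⟨b, hb, hR⟩ := hpar n b' hb'
      obtain ⟨p, hpT, hpR, hpn⟩ := ih b hb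
      refine ⟨fun m => if m ≤ n then p m else b', fun m hm => ?_, fun m hm => ?_, by simp⟩
      · by_cases h : m ≤ n
        · simpa [h] using hpT m h
        · obtain rfl : m = n + 1 := by omega
          simpa using hb'
      · by_cases h : m < n
        · simpa [h.le, Nat.succ_le_of_lt h] using hpR m h
        · obtain rfl : m = n := by omega
          simpa [hpn] using hR
  choose c hc using hne
  choose p hpT hpR _ using fun n => hpath n (c n) (hc n)
  have hlim : ∀ m, ∃ b ∈ T m, ∀ᶠ n in (hyperfilter ℕ : Filter ℕ), p n m = b := by
    intro m
    rw [← Ultrafilter.eventually_exists_mem_iff (hfin m)]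
    filter_upwards [Nat.hyperfilter_le_atTop (eventually_ge_atTop m)] with n hn
    exact ⟨_, hpT n m hn, rfl⟩
  choose s hsT hs using hlim
  refine ⟨s, hsT, fun m => ?_⟩
  obtain ⟨n, h₁, h₂, hn⟩ := ((hs m).and ((hs (m + 1)).and
    (Nat.hyperfilter_le_atTop (eventually_gt_atTop m)))).exists
  rw [← h₁, ← h₂]
  exact hpR n m hn

/-! ### Consonance of spaces with a complete scheme of formal balls -/

/-- A space is consonant if every member `U` of a Scott-open family `H` of open sets contains a
compact set all of whose open neighbourhoods belong to `H`. -/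
def IsConsonant (Z : Type*) [TopologicalSpace Z] : Prop :=
  ∀ H : Set (OpenSets Z), IsOpen H → ∀ U : Opens Z, toScott U ∈ H →
    ∃ K : Set Z, IsCompact K ∧ K ⊆ U ∧ ∀ V : Opens Z, K ⊆ V → toScott V ∈ H

/-- A complete scheme of formal balls: a base of open sets `ball b` indexed by formal balls, with a
relation `R b' b` (`b'` refines `b`) such that the refinements of `b` cover `ball b`, and such that
the balls of every chain of successive refinements form a neighbourhood base of some point. -/
structure IsCompleteBallScheme {Z B : Type*} [TopologicalSpace Z] (ball : B → Opens Z)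
    (R : B → B → Prop) : Prop where
  le : ∀ {b' b}, R b' b → ball b' ≤ ball b
  exists_refinement : ∀ {z b}, z ∈ ball b → ∃ b', R b' b ∧ z ∈ ball b'
  exists_ball : ∀ {z} {U : Opens Z}, z ∈ U → ∃ b, z ∈ ball b ∧ ball b ≤ U
  converges : ∀ s : ℕ → B, (∀ n, R (s (n + 1)) (s n)) →
    ∃ a, (∀ n, a ∈ ball (s n)) ∧ ∀ U : Opens Z, a ∈ U → ∃ n, ball (s n) ≤ U

namespace IsCompleteBallScheme

variable {Z B : Type*} [TopologicalSpace Z] {ball : B → Opens Z} {R : B → B → Prop}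

theorem exists_finset_refinement (h : IsCompleteBallScheme ball R) {H : Set (OpenSets Z)}
    (hH : IsOpen H) (F : Finset B) (hF : toScott (⨆ b ∈ F, ball b) ∈ H) :
    ∃ F' : Finset B, toScott (⨆ b ∈ F', ball b) ∈ H ∧ ∀ b' ∈ F', ∃ b ∈ F, R b' b := by
  classical
  obtain ⟨t, ht⟩ := OpenSets.exists_finset_iSup_mem hH
    (fun b' : {b' // ∃ b ∈ F, R b' b} => ball b') (by
      refine OpenSets.mem_of_isOpen_of_le hH hF fun z hz => ?_
      simp only [Opens.mem_iSup, exists_prop] at hz ⊢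
      obtain ⟨b, hb, hz⟩ := hz
      obtain ⟨b', hR, hz'⟩ := h.exists_refinement hz
      exact ⟨⟨b', b, hb, hR⟩, hz'⟩)
  refine ⟨t.image Subtype.val, ?_, fun b' hb' => ?_⟩
  · rwa [Finset.iSup_finset_image]
  · obtain ⟨c, _, rfl⟩ := Finset.mem_image.1 hb'
    exact c.2

/-- In a tree of finitely many refinements at each stage, a property of sets that is inherited by
subsets and finite unions, and that holds near every point of the intersection of the stages, holds
for some stage. -/
theorem exists_stage (h : IsCompleteBallScheme ball R) {F : ℕ → Finset B}
    (hF : ∀ n, ∀ b' ∈ F (n + 1), ∃ b ∈ F n, R b' b) {p : Opens Z → Prop} (hbot : p ⊥)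
    (hmono : ∀ U V, U ≤ V → p V → p U) (hsup : ∀ U V, p U → p V → p (U ⊔ V))
    (hp : ∀ a, (∀ n, a ∈ ⨆ b ∈ F n, ball b) → ∃ U : Opens Z, a ∈ U ∧ p U) :
    ∃ n, p (⨆ b ∈ F n, ball b) := by
  by_contra! hn
  have hbad : ∀ n, ∃ b ∈ F n, ¬ p (ball b) := by
    intro n
    by_contra! hb
    refine hn n ?_
    rw [← Finset.sup_eq_iSup]
    exact Finset.sup_induction hbot (fun U hU V hV => hsup U V hU hV) hb
  obtain ⟨s, hs, hR⟩ := exists_chain_of_finite_levels (R := R)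
    (T := fun n => {b | b ∈ F n ∧ ¬ p (ball b)})
    (fun n => (F n).finite_toSet.subset fun b hb => hb.1) hbad
    (fun n b' hb' => by
      obtain ⟨b, hb, hR⟩ := hF n b' hb'.1
      exact ⟨b, ⟨hb, fun hpb => hb'.2 (hmono _ _ (h.le hR) hpb)⟩, hR⟩)
  obtain ⟨a, ha, hbase⟩ := h.converges s hR
  obtain ⟨U, haU, hU⟩ := hp a fun n => by
    simpa [Opens.mem_iSup] using ⟨s n, (hs n).1, ha n⟩
  obtain ⟨n, hnU⟩ := hbase U haU
  exact (hs n).2 (hmono _ _ hnU hU)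

theorem isConsonant (h : IsCompleteBallScheme ball R) : IsConsonant Z := by
  intro H hH U hU
  obtain ⟨F₀, hF₀, hF₀U⟩ : ∃ F : Finset B, toScott (⨆ b ∈ F, ball b) ∈ H ∧
      ⨆ b ∈ F, ball b ≤ U := by
    classical
    obtain ⟨t, ht⟩ := OpenSets.exists_finset_iSup_mem hH
      (fun b : {b // ball b ≤ U} => ball b) (by
        refine OpenSets.mem_of_isOpen_of_le hH hU fun z hz => ?_
        obtain ⟨b, hzb, hb⟩ := h.exists_ball hz
        exact Opens.mem_iSup.2 ⟨⟨b, hb⟩, hzb⟩)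
    refine ⟨t.image Subtype.val, ?_, ?_⟩
    · rwa [Finset.iSup_finset_image]
    · rw [Finset.iSup_finset_image]
      exact iSup₂_le fun b _ => b.2
  choose! next hnext hnextR using h.exists_finset_refinement hH
  let F : ℕ → Finset B := fun n => next^[n] F₀
  have hsucc : ∀ n, F (n + 1) = next (F n) := fun n => Function.iterate_succ_apply' next n F₀
  have hFH : ∀ n, toScott (⨆ b ∈ F n, ball b) ∈ H := by
    intro n
    induction n with
    | zero => exact hF₀
    | succ n ih =>
      rw [hsucc]
      exact hnext _ ih
  have hFR : ∀ n, ∀ b' ∈ F (n + 1), ∃ b ∈ F n, R b' b := by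
    intro n
    rw [hsucc]
    exact hnextR _ (hFH n)
  let K : Set Z := {z | ∀ n, z ∈ ⨆ b ∈ F n, ball b}
  refine ⟨K, ?_, fun z hz => hF₀U (hz 0), fun V hV => ?_⟩
  · -- A filter on `K` without cluster points is disjoint from some open set around every point of
    -- `K`, hence from some stage; but every stage contains `K`.
    intro f hf hfK
    by_contra! hcl
    obtain ⟨n, hn⟩ := h.exists_stage hFR (p := fun W => (W : Set Z)ᶜ ∈ f) (by simp)
      (fun W W' hWW' hW' => mem_of_superset hW' (Set.compl_subset_compl.2 hWW'))
      (fun W W' hW hW' => by simpa [Set.compl_union] using ⟨hW, hW'⟩)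
      (fun a ha => by
        have hdis : Disjoint (𝓝 a) f := by
          simpa [ClusterPt, disjoint_iff] using hcl a ha
        obtain ⟨s, hs, hsf⟩ := Filter.disjoint_iff.1 hdis
        obtain ⟨t, ht, hst⟩ := hsf
        obtain ⟨O, hOs, hO, haO⟩ := mem_nhds_iff.1 hs
        exact ⟨⟨O, hO⟩, haO, mem_of_superset ht fun x hx hxO =>
          Set.disjoint_left.1 hst (hOs hxO) hx⟩)
    refine hf.ne (empty_mem_iff_bot.1 ?_)
    filter_upwards [hn, hfK (mem_principal_self K)] with z hz hzK
    exact hz (hzK n)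
  · obtain ⟨n, hn⟩ := h.exists_stage hFR (p := fun W => W ≤ V) bot_le
      (fun _ _ => le_trans) (fun _ _ => sup_le) (fun a ha => ⟨V, hV ha, le_rfl⟩)
    exact OpenSets.mem_of_isOpen_of_le hH (hFH n) hn

/-- The scheme on a disjoint sum of copies of `Z`, with the balls of each copy. -/
theorem sigma (h : IsCompleteBallScheme ball R) (ι : Type*) :
    IsCompleteBallScheme (Z := Σ _ : ι, Z) (B := ι × B)
      (fun b => ⟨Sigma.mk b.1 '' (ball b.2 : Set Z), isOpenMap_sigmaMk _ (ball b.2).isOpen⟩)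
      (fun b' b => b'.1 = b.1 ∧ R b'.2 b.2) where
  le := by
    rintro ⟨i, b'⟩ ⟨j, b⟩ ⟨hij, hR⟩
    obtain rfl : i = j := hij
    exact Set.image_mono (h.le hR)
  exists_refinement := by
    rintro _ ⟨i, b⟩ ⟨z, hz, rfl⟩
    obtain ⟨b', hR, hz'⟩ := h.exists_refinement hz
    exact ⟨(i, b'), ⟨rfl, hR⟩, z, hz', rfl⟩
  exists_ball := by
    rintro ⟨i, z⟩ U hz
    obtain ⟨b, hzb, hb⟩ :=
      h.exists_ball (U := Opens.comap ⟨Sigma.mk i, continuous_sigmaMk⟩ U) hz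
    exact ⟨(i, b), ⟨z, hzb, rfl⟩, Set.image_subset_iff.2 hb⟩
  converges := by
    intro s hs
    have hconst : ∀ n, (s n).1 = (s 0).1 := by
      intro n
      induction n with
      | zero => rfl
      | succ n ih => exact (hs n).1.trans ih
    obtain ⟨a, ha, hbase⟩ := h.converges (fun n => (s n).2) fun n => (hs n).2
    refine ⟨⟨(s 0).1, a⟩, fun n => ⟨a, ha n, by rw [hconst n]⟩, fun U hU => ?_⟩
    obtain ⟨n, hn⟩ := hbase (Opens.comap ⟨Sigma.mk (s 0).1, continuous_sigmaMk⟩ U) hU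
    refine ⟨n, ?_⟩
    rw [← SetLike.coe_subset_coe]
    change Sigma.mk (s n).1 '' _ ⊆ _
    rw [hconst n]
    exact Set.image_subset_iff.2 hn

end IsCompleteBallScheme

/-! ### Formal balls in Smyth-complete quasi-metric spaces -/

section QuasiMetric

variable {X : Type*} [TopologicalSpace X] {d : X → X → ℝ}

theorem InducesTopology.isOpen_ball (hd : IsQuasiMetric d) (ht : InducesTopology d) (x : X)
    (r : ℝ) : IsOpen {y | d x y < r} := by
  refine (ht _).2 fun y hy => ⟨r - d x y, sub_pos.2 hy, fun z hz => ?_⟩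
  have := hd.triangle x y z
  simp only [Set.mem_ofPred_eq] at hy hz ⊢
  linarith

/-- The formal balls `(x, r)` of a Smyth-complete quasi-metric form a complete scheme, `(x', r')`
refining `(x, r)` if `0 < r' ≤ r / 2` and `d x x' + r' < r`. -/
theorem IsSmythComplete.isCompleteBallScheme (hd : IsQuasiMetric d) (hc : IsSmythComplete d)
    (ht : InducesTopology d) :
    IsCompleteBallScheme
      (fun b : X × ℝ => (⟨{y | d b.1 y < b.2}, ht.isOpen_ball hd b.1 b.2⟩ : Opens X))
      (fun b' b => 0 < b'.2 ∧ b'.2 ≤ b.2 / 2 ∧ d b.1 b'.1 + b'.2 < b.2) where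
  le := by
    rintro ⟨x', r'⟩ ⟨x, r⟩ ⟨_, _, hR⟩ y (hy : d x' y < r')
    have := hd.triangle x x' y
    change d x y < r
    dsimp only at hR
    linarith
  exists_refinement := by
    rintro y ⟨x, r⟩ (hy : d x y < r)
    have h0 := hd.nonneg x y
    have hyy : d y y = 0 := ((hd.eq_iff y y).1 rfl).1
    refine ⟨(y, (r - d x y) / 2), ⟨?_, ?_, ?_⟩, ?_⟩
    · dsimp only; linarith
    · dsimp only; linarith
    · dsimp only; linarith
    · change d y y < (r - d x y) / 2
      linarith
  exists_ball := by
    intro z U hz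
    obtain ⟨ε, hε, hεU⟩ := (ht U).1 U.isOpen z hz
    refine ⟨(z, ε), ?_, hεU⟩
    change d z z < ε
    rwa [((hd.eq_iff z z).1 rfl).1]
  converges := by
    intro s hs
    have hpos : ∀ n, 0 < (s n).2 := fun n => by
      have := hs n
      linarith [this.1, this.2.1]
    have hpow : ∀ n, (s n).2 ≤ (s 0).2 * (1 / 2) ^ n := by
      intro n
      induction n with
      | zero => simp
      | succ n ih =>
        have := (hs n).2.1
        rw [pow_succ]
        linarith
    have hsmall : ∀ ε > 0, ∃ N, ∀ n, N ≤ n → (s n).2 < ε := by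
      intro ε hε
      have hlim : Tendsto (fun n : ℕ => (s 0).2 * (1 / 2 : ℝ) ^ n) atTop (𝓝 0) := by
        simpa using (tendsto_pow_atTop_nhds_zero_of_lt_one (r := (1 / 2 : ℝ)) (by norm_num)
          (by norm_num)).const_mul (s 0).2
      obtain ⟨N, hN⟩ := eventually_atTop.1 (hlim.eventually (gt_mem_nhds hε))
      exact ⟨N, fun n hn => (hpow n).trans_lt (hN n hn)⟩
    have hdist : ∀ n k, d (s n).1 (s (n + k)).1 + (s (n + k)).2 ≤ (s n).2 := by
      intro n k
      induction k with
      | zero => simp [((hd.eq_iff (s n).1 (s n).1).1 rfl).1]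
      | succ k ih =>
        have h₁ := (hs (n + k)).2.2
        have h₂ := hd.triangle (s n).1 (s (n + k)).1 (s (n + k + 1)).1
        rw [← add_assoc]
        linarith
    obtain ⟨a, ha⟩ := hc (fun n => (s n).1) (by
      intro ε hε
      obtain ⟨N, hN⟩ := hsmall ε hε
      refine ⟨N, fun n m hn hm => ?_⟩
      obtain ⟨k, rfl⟩ := Nat.exists_eq_add_of_le hm
      have := hdist n k
      have := hpos (n + k)
      have := hN n hn
      dsimp only
      linarith)
    have hle : ∀ n, d (s n).1 a ≤ (s n).2 := by
      intro n
      refine le_of_forall_pos_le_add fun ε hε => ?_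
      obtain ⟨N, hN⟩ := ha ε hε
      have h₁ := (le_max_left _ _).trans_lt (hN (n + N) (by omega))
      have h₂ := hdist n N
      have h₃ := hpos (n + N)
      have h₄ := hd.triangle (s n).1 (s (n + N)).1 a
      linarith
    refine ⟨a, fun n => ?_, fun U hU => ?_⟩
    · -- The limit lies in the closed ball of the next term, which is inside the open ball `s n`.
      have h₁ := hle (n + 1)
      have h₂ := (hs n).2.2
      have h₃ := hd.triangle (s n).1 (s (n + 1)).1 a
      change d (s n).1 a < (s n).2
      linarith
    · obtain ⟨ε, hε, hεU⟩ := (ht U).1 U.isOpen a hU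
      obtain ⟨N, hN⟩ := hsmall (ε / 2) (half_pos hε)
      obtain ⟨M, hM⟩ := ha (ε / 2) (half_pos hε)
      refine ⟨max N M, fun y hy => hεU ?_⟩
      have h₁ := hN _ (le_max_left N M)
      have h₂ := (le_max_right _ _).trans_lt (hM _ (le_max_right N M))
      have h₃ := hd.triangle a (s (max N M)).1 y
      change d (s (max N M)).1 y < (s (max N M)).2 at hy
      change d a y < ε
      linarith

end QuasiMetric

theorem QuasiPolishSpace.isConsonant (X : Type*) [TopologicalSpace X] [QuasiPolishSpace X] :
    IsConsonant X := by
  obtain ⟨d, hd, hc, ht⟩ := QuasiPolishSpace.exists_quasiMetric (X := X)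
  exact (hc.isCompleteBallScheme hd ht).isConsonant

theorem QuasiPolishSpace.isConsonant_sigma (X : Type*) [TopologicalSpace X] [QuasiPolishSpace X]
    (ι : Type*) : IsConsonant (Σ _ : ι, X) := by
  obtain ⟨d, hd, hc, ht⟩ := QuasiPolishSpace.exists_quasiMetric (X := X)
  exact ((hc.isCompleteBallScheme hd ht).sigma ι).isConsonant

/-! ### The upper powerspace -/

namespace UpperPowerspace

variable {X : Type*} [TopologicalSpace X]

/-- The saturation of a compact set, i.e. its set of points above some point of the given set. -/
def ofIsCompact (K : Set X) (hK : IsCompact K) : UpperPowerspace X where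
  carrier := nhdsKer K
  isCompact_carrier := hK.nhdsKer
  saturated := by rw [← nhdsKer_def, nhdsKer_nhdsKer]

theorem ofIsCompact_mem_box {K : Set X} {hK : IsCompact K} {U : Opens X} :
    ofIsCompact K hK ∈ box U ↔ K ⊆ U :=
  U.isOpen.nhdsKer_subset

theorem map_mem_box_iff {Y : Type*} [TopologicalSpace Y] (f : C(X, Y)) (K : UpperPowerspace X)
    (U : Opens Y) : map f K ∈ box U ↔ K ∈ box (Opens.comap f U) := by
  constructor
  · exact fun hK x hx => hK ⟨x, hx, subset_closure rfl⟩
  · rintro hK y ⟨x, hx, hxy⟩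
    exact (specializes_iff_mem_closure.2 hxy).mem_open U.isOpen (hK hx)

theorem isTopologicalBasis_box : IsTopologicalBasis (Set.range (box (X := X))) where
  exists_subset_inter := by
    rintro _ ⟨U, rfl⟩ _ ⟨V, rfl⟩ K ⟨hU, hV⟩
    exact ⟨_, ⟨U ⊓ V, rfl⟩, Set.subset_inter hU hV,
      fun L hL => ⟨hL.trans Set.inter_subset_left, hL.trans Set.inter_subset_right⟩⟩
  sUnion_eq := Set.eq_univ_of_forall fun _ => ⟨_, ⟨⊤, rfl⟩, Set.subset_univ _⟩
  eq_generateFrom := rfl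

end UpperPowerspace

/-! ### The maps `α` and `β` -/

section AlphaBeta

variable {X : Type*} [TopologicalSpace X]

theorem mem_alphaMap {𝔄 : LowerPowerspace (OpenSets X)} {K : UpperPowerspace X} :
    K ∈ (ofScott (alphaMap X 𝔄) : Opens _) ↔ ∃ U ∈ 𝔄.carrier, K ∈ box (ofScott U) := by
  change K ∈ ⋃ U ∈ 𝔄.carrier, box (ofScott U) ↔ _
  simp

theorem alphaMap_betaMap (𝒰 : OpenSets (UpperPowerspace X)) :
    alphaMap X (betaMap X 𝒰) = 𝒰 := by
  refine SetLike.ext (p := ofScott (alphaMap X (betaMap X 𝒰))) (q := ofScott 𝒰) fun K => ?_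
  rw [mem_alphaMap]
  constructor
  · rintro ⟨U, hU, hK⟩
    exact hU hK
  · intro hK
    obtain ⟨_, ⟨U, rfl⟩, hKU, hU⟩ :=
      UpperPowerspace.isTopologicalBasis_box.exists_subset_of_mem_open hK (ofScott 𝒰).isOpen
    exact ⟨toScott U, hU, hKU⟩

theorem betaMap_alphaMap (hX : IsConsonant X) (𝔄 : LowerPowerspace (OpenSets X)) :
    betaMap X (alphaMap X 𝔄) = 𝔄 := by
  refine LowerPowerspace.ext (Set.Subset.antisymm (fun U hU => ?_) fun U hU K hK =>
    mem_alphaMap.2 ⟨U, hU, hK⟩)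
  by_contra hUA
  obtain ⟨K, hK, hKU, hKA⟩ := hX _ 𝔄.isClosed_carrier.isOpen_compl (ofScott U) hUA
  obtain ⟨V, hVA, hKV⟩ := mem_alphaMap.1 (hU (UpperPowerspace.ofIsCompact_mem_box (hK := hK).2 hKU))
  exact hKA (ofScott V) (UpperPowerspace.ofIsCompact_mem_box.1 hKV) hVA

theorem continuous_betaMap (hX : IsConsonant X) : Continuous (betaMap X) := by
  refine continuous_generateFrom_iff.2 ?_
  rintro _ ⟨𝓗, rfl⟩
  refine OpenSets.isOpen_of_upper_of_directed ?_ ?_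
  · rintro 𝒰 𝒱 h ⟨U, hU, hUH⟩
    exact ⟨U, Set.Subset.trans hU h, hUH⟩
  · rintro D - hD ⟨U, hU, hUH⟩
    obtain ⟨K, hK, hKU, hKH⟩ := hX 𝓗 𝓗.isOpen (ofScott U) hUH
    have hmem : UpperPowerspace.ofIsCompact K hK ∈ sSup D :=
      hU (UpperPowerspace.ofIsCompact_mem_box.2 hKU)
    obtain ⟨𝒰, h𝒰, hK𝒰⟩ := Opens.mem_sSup.1 hmem
    obtain ⟨_, ⟨V, rfl⟩, hKV, hV⟩ :=
      UpperPowerspace.isTopologicalBasis_box.exists_subset_of_mem_open hK𝒰 𝒰.isOpen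
    exact ⟨𝒰, h𝒰, toScott V, hV, hKH V (UpperPowerspace.ofIsCompact_mem_box.1 hKV)⟩

/-- The open set `⋃ i, □(W i)` of `K(X)`, where the family `W` of open sets of `X` is
encoded as an open set of the disjoint sum of copies of `X`. -/
def sigmaBox {ι : Type*} (W : Opens (Σ _ : ι, X)) : Opens (UpperPowerspace X) :=
  ⨆ i, ⟨box (Opens.comap ⟨Sigma.mk i, continuous_sigmaMk⟩ W), isOpen_box _⟩

theorem mem_sigmaBox {ι : Type*} {W : Opens (Σ _ : ι, X)} {K : UpperPowerspace X} :
    K ∈ sigmaBox W ↔ ∃ i, Sigma.mk i '' K.carrier ⊆ (W : Set (Σ _ : ι, X)) := by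
  simp only [sigmaBox, Opens.mem_iSup, Set.image_subset_iff]
  rfl

theorem isOpen_preimage_sigmaBox {ι : Type*} {ℋ : Set (OpenSets (UpperPowerspace X))}
    (hℋ : IsOpen ℋ) :
    IsOpen {W : OpenSets (Σ _ : ι, X) | toScott (sigmaBox (ofScott W)) ∈ ℋ} := by
  have hmono : ∀ V W : Opens (Σ _ : ι, X), V ≤ W → sigmaBox V ≤ sigmaBox W := by
    intro V W hVW K hK
    obtain ⟨i, hi⟩ := mem_sigmaBox.1 hK
    exact mem_sigmaBox.2 ⟨i, hi.trans hVW⟩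
  refine OpenSets.isOpen_of_upper_of_directed
    (fun V W hVW hV => OpenSets.mem_of_isOpen_of_le hℋ hV (hmono V W hVW)) ?_
  intro D hne hD h
  have hlub : IsLUB ((fun W => (toScott (sigmaBox W) : OpenSets (UpperPowerspace X))) '' D)
      (toScott (sigmaBox (sSup D))) := by
    refine ⟨?_, fun 𝒱 h𝒱 K hK => ?_⟩
    · rintro _ ⟨W, hW, rfl⟩
      exact hmono _ _ (le_sSup hW)
    · obtain ⟨i, hi⟩ := mem_sigmaBox.1 hK
      obtain ⟨W, hW, hKW⟩ :=
        (K.isCompact_carrier.image continuous_sigmaMk).exists_mem_subset_of_subset_sSup hne hD hi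
      exact h𝒱 ⟨W, hW, rfl⟩ (mem_sigmaBox.2 ⟨i, hKW⟩)
  have hdir : DirectedOn (· ≤ ·)
      ((fun W => (toScott (sigmaBox W) : OpenSets (UpperPowerspace X))) '' D) := by
    rintro _ ⟨V, hV, rfl⟩ _ ⟨W, hW, rfl⟩
    obtain ⟨O, hO, hVO, hWO⟩ := hD V hV W hW
    exact ⟨_, ⟨O, hO, rfl⟩, hmono _ _ hVO, hmono _ _ hWO⟩
  obtain ⟨_, ⟨W, hW, rfl⟩, hWℋ⟩ :=
    ((IsScott.isOpen_iff_isUpperSet_and_dirSupInaccOn (D := Set.univ)).1 hℋ).2 trivial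
      (hne.image _) hdir hlub h
  exact ⟨W, hW, hWℋ⟩

/-- Joint continuity of `(U₁, …, Uₙ) ↦ □U₁ ∪ ⋯ ∪ □Uₙ` comes from consonance of the `n`-fold sum: a
compact subset of the sum consists of compact sets `Kᵢ`, and `{V | Kᵢ ⊆ V}` is a Scott-open
neighbourhood of `Uᵢ`. -/
theorem continuous_alphaMap (hX : ∀ t : Finset (OpenSets X), IsConsonant (Σ _ : t, X)) :
    Continuous (alphaMap X) := by
  refine continuous_def.2 fun ℋ hℋ => isOpen_iff_mem_nhds.2 fun 𝔄 h𝔄 => ?_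
  obtain ⟨t, ht⟩ := OpenSets.exists_finset_iSup_mem hℋ
    (fun U : 𝔄.carrier => (⟨box (ofScott U.1), isOpen_box _⟩ : Opens (UpperPowerspace X)))
    (OpenSets.mem_of_isOpen_of_le hℋ (U := ofScott (alphaMap X 𝔄)) h𝔄 fun K hK => by
      obtain ⟨U, hU, hKU⟩ := mem_alphaMap.1 hK
      exact Opens.mem_iSup.2 ⟨⟨U, hU⟩, hKU⟩)
  classical
  let t' : Finset (OpenSets X) := t.image Subtype.val
  have ht' : ∀ U ∈ t', U ∈ 𝔄.carrier := by
    intro U hU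
    obtain ⟨V, _, rfl⟩ := Finset.mem_image.1 hU
    exact V.2
  let W : Opens (Σ _ : t', X) :=
    ⟨{z | z.2 ∈ (ofScott z.1.1 : Opens X)}, isOpen_sigma_iff.2 fun U => (ofScott U.1).isOpen⟩
  obtain ⟨L, hL, hLW, hLℋ⟩ := hX t' _ (isOpen_preimage_sigmaBox hℋ) W (by
    refine OpenSets.mem_of_isOpen_of_le hℋ ht fun K hK => ?_
    simp only [Opens.mem_iSup, exists_prop] at hK
    obtain ⟨U, hU, hKU⟩ := hK
    refine mem_sigmaBox.2 ⟨⟨U.1, Finset.mem_image_of_mem _ hU⟩, ?_⟩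
    exact Set.image_subset_iff.2 hKU)
  have hLc : ∀ U : t', IsCompact (Sigma.mk U ⁻¹' L) :=
    fun U => Topology.IsClosedEmbedding.sigmaMk.isCompact_preimage hL
  let 𝓗 : t' → Opens (OpenSets X) := fun U =>
    ⟨{V | Sigma.mk U ⁻¹' L ⊆ (ofScott V : Opens X)}, OpenSets.isOpen_setOf_subset (hLc U)⟩
  have hopen : IsOpen (⋂ U : t', LowerPowerspace.dia (𝓗 U)) :=
    isOpen_iInter_of_finite fun U => isOpen_generateFrom_of_mem ⟨𝓗 U, rfl⟩
  refine mem_of_superset (hopen.mem_nhds (Set.mem_iInter.2 fun U =>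
    ⟨U.1, ht' _ U.2, fun x hx => hLW hx⟩)) fun 𝔅 h𝔅 => ?_
  choose V hV𝔅 hLV using Set.mem_iInter.1 h𝔅
  refine OpenSets.mem_of_isOpen_of_le hℋ (V := ofScott (alphaMap X 𝔅))
    (hLℋ ⟨{z | z.2 ∈ (ofScott (V z.1) : Opens X)},
      isOpen_sigma_iff.2 fun U => (ofScott (V U)).isOpen⟩ fun z hz => hLV z.1 hz) fun K hK => ?_
  obtain ⟨U, hU⟩ := mem_sigmaBox.1 hK
  exact mem_alphaMap.2 ⟨V U, hV𝔅 U, fun x hx => hU ⟨x, hx, rfl⟩⟩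

theorem alphaMap_naturality {Y : Type*} [TopologicalSpace Y] (f : C(X, Y))
    (𝔄 : LowerPowerspace (OpenSets Y)) :
    alphaMap X (LowerPowerspace.map (OpenSets.map f) 𝔄) =
      OpenSets.map (UpperPowerspace.map f) (alphaMap Y 𝔄) := by
  refine SetLike.ext (p := ofScott (alphaMap X (LowerPowerspace.map (OpenSets.map f) 𝔄)))
    (q := ofScott (OpenSets.map (UpperPowerspace.map f) (alphaMap Y 𝔄))) fun K => ?_
  change _ ↔ UpperPowerspace.map f K ∈ (ofScott (alphaMap Y 𝔄) : Opens _)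
  rw [mem_alphaMap, mem_alphaMap]
  constructor
  · rintro ⟨U, hU, hKU⟩
    obtain ⟨_, hKV, V, hV, rfl⟩ :=
      mem_closure_iff.1 hU _ (OpenSets.isOpen_setOf_subset K.isCompact_carrier) hKU
    exact ⟨V, hV, (UpperPowerspace.map_mem_box_iff f K _).2 hKV⟩
  · rintro ⟨V, hV, hKV⟩
    exact ⟨OpenSets.map f V, subset_closure ⟨V, hV, rfl⟩,
      (UpperPowerspace.map_mem_box_iff f K _).1 hKV⟩

end AlphaBeta

theorem mainTheorem3 (X : Type*) [TopologicalSpace X] [QuasiPolishSpace X] :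
    (∃ h : LowerPowerspace (OpenSets X) ≃ₜ OpenSets (UpperPowerspace X),
      (∀ 𝔄, h 𝔄 = alphaMap X 𝔄) ∧ (∀ 𝒰, h.symm 𝒰 = betaMap X 𝒰)) ∧
    (∀ (Y : Type*) [TopologicalSpace Y] [QuasiPolishSpace Y] (f : C(X, Y)),
      (∀ 𝔄 : LowerPowerspace (OpenSets Y),
        alphaMap X (LowerPowerspace.map (OpenSets.map f) 𝔄) =
          OpenSets.map (UpperPowerspace.map f) (alphaMap Y 𝔄)) ∧
      (∀ 𝒰 : OpenSets (UpperPowerspace Y),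
        betaMap X (OpenSets.map (UpperPowerspace.map f) 𝒰) =
          LowerPowerspace.map (OpenSets.map f) (betaMap Y 𝒰))) := by
  have hX := QuasiPolishSpace.isConsonant X
  refine ⟨⟨{ toFun := alphaMap X
             invFun := betaMap X
             left_inv := betaMap_alphaMap hX
             right_inv := alphaMap_betaMap
             continuous_toFun :=
              continuous_alphaMap fun t => QuasiPolishSpace.isConsonant_sigma X t
             continuous_invFun := continuous_betaMap hX }, fun _ => rfl, fun _ => rfl⟩, ?_⟩
  intro Y _ _ f
  refine ⟨alphaMap_naturality f, fun 𝒰 => ?_⟩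
  conv_lhs => rw [← alphaMap_betaMap 𝒰, ← alphaMap_naturality, betaMap_alphaMap hX]
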